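/- For a semigroup $S$, a weight on $S$ is a function $\omega:S\to(0,\infty)$ with $\omega(st)\le\omega(s)\omega(t)$ for all $s,t\in S$. Let $\ell_1(S,\omega)$ be the space of all $g:S\to\mathbb{C}$ with $\|g\|_{\omega,1}=\sum_{s\in S}|g(s)|\,\omega(s)<\infty$, with this norm and the convolution product $(f*g)(s)=\sum_{uv=s}f(u)g(v)$, and write $\ell_1(S)=\ell_1(S,1)$. A Banach algebra $A$ is called Arens regular if the two Arens products on its second dual $A^{**}$ coincide, that is, $m\,\square\,n=m\,\lozenge\,n$ for all $m,n\in A^{**}$, where $(m\,\square\,n)(f)=m(n\cdot f)$ with $(n\cdot f)(a)=n(f\cdot a)$, $(f\cdot a)(b)=f(ab)$, and $(m\,\lozenge\,n)(f)=n(f\cdot m)$ with $(f\cdot m)(a)=m(a\cdot f)$, $(a\cdot f)(b)=f(ba)$, for $f\in A^*$ and $a,b\in A$. Let $\psi:S\to T$ be a homomorphism of semigroups from $S$ onto $T$. If $\ell_1(S)$ is Arens regular, then $\ell_1(T,\omega)$ is Arens regular for every weight $\omega$ on $T$. -/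

import Mathlib

noncomputable section

/-- The adjoint of a bounded bilinear map `B : X × Y → Z`: it is the bounded bilinear map
`Z' × X → Y'`, `(f, x) ↦ (y ↦ f (B x y))`. -/
def arensAdjoint {X Y Z : Type*} [NormedAddCommGroup X] [NormedSpace ℂ X]
    [NormedAddCommGroup Y] [NormedSpace ℂ Y] [NormedAddCommGroup Z] [NormedSpace ℂ Z]
    (B : X →L[ℂ] Y →L[ℂ] Z) : (Z →L[ℂ] ℂ) →L[ℂ] X →L[ℂ] (Y →L[ℂ] ℂ) :=
  ((ContinuousLinearMap.compL ℂ X (Y →L[ℂ] Z) (Y →L[ℂ] ℂ)).flip B).comp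
    (ContinuousLinearMap.compL ℂ Y Z ℂ)

theorem arensAdjoint_apply {X Y Z : Type*} [NormedAddCommGroup X] [NormedSpace ℂ X]
    [NormedAddCommGroup Y] [NormedSpace ℂ Y] [NormedAddCommGroup Z] [NormedSpace ℂ Z]
    (B : X →L[ℂ] Y →L[ℂ] Z) (f : Z →L[ℂ] ℂ) (x : X) (y : Y) :
    arensAdjoint B f x y = f (B x y) := rfl

section Arens

variable (A : Type*) [NonUnitalNormedRing A] [NormedSpace ℂ A] [IsScalarTower ℂ A A]
  [SMulCommClass ℂ A A]

/-- The first Arens product `m □ n` on the second dual of a normed algebra `A`: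
`(m □ n) f = m (n · f)`, where `(n · f) a = n (f · a)` and `(f · a) b = f (a * b)`. -/
def firstArensProduct (m n : (A →L[ℂ] ℂ) →L[ℂ] ℂ) : (A →L[ℂ] ℂ) →L[ℂ] ℂ :=
  m.comp (arensAdjoint (arensAdjoint (ContinuousLinearMap.mul ℂ A)) n)

/-- The second Arens product `m ◇ n` on the second dual of a normed algebra `A`:
`(m ◇ n) f = n (f · m)`, where `(f · m) a = m (a · f)` and `(a · f) b = f (b * a)`. -/
def secondArensProduct (m n : (A →L[ℂ] ℂ) →L[ℂ] ℂ) : (A →L[ℂ] ℂ) →L[ℂ] ℂ :=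
  n.comp (arensAdjoint (arensAdjoint (ContinuousLinearMap.mul ℂ A).flip) m)

/-- `A` is Arens regular if its two Arens products on the second dual coincide. -/
def IsArensRegular : Prop :=
  ∀ m n : (A →L[ℂ] ℂ) →L[ℂ] ℂ, firstArensProduct A m n = secondArensProduct A m n

end Arens

/-- A weight on a semigroup: a function `ω : S → (0, ∞)` with `ω (s * t) ≤ ω s * ω t`. -/
structure SemigroupWeight (S : Type*) [Semigroup S] where
  /-- the underlying function -/
  toFun : S → ℝ
  pos : ∀ s, 0 < toFun s
  submul : ∀ s t, toFun (s * t) ≤ toFun s * toFun t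

instance {S : Type*} [Semigroup S] : CoeFun (SemigroupWeight S) (fun _ => S → ℝ) :=
  ⟨SemigroupWeight.toFun⟩

/-- The trivial weight, constantly `1`. -/
def trivialWeight (S : Type*) [Semigroup S] : SemigroupWeight S where
  toFun _ := 1
  pos _ := one_pos
  submul _ _ := by norm_num

/-- The linear space of all `g : S → ℂ` with `∑ s, |g s| ω s < ∞`. -/
def weightedL1Submodule {S : Type*} [Semigroup S] (ω : SemigroupWeight S) :
    Submodule ℂ (S → ℂ) where
  carrier := {g | Summable fun s => ‖g s‖ * ω s}
  zero_mem' := by simp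
  add_mem' {f g} hf hg := by
    refine Summable.of_nonneg_of_le
      (fun s => mul_nonneg (norm_nonneg _) (ω.pos s).le) (fun s => ?_) (hf.add hg)
    rw [← add_mul]
    exact mul_le_mul_of_nonneg_right (norm_add_le _ _) (ω.pos s).le
  smul_mem' c f hf := by
    have : (fun s => ‖(c • f) s‖ * ω s) = fun s => ‖c‖ * (‖f s‖ * ω s) := by
      funext s; simp [mul_assoc]
    rw [Set.mem_ofPred_eq, this]
    exact Summable.mul_left _ hf

/-- The weighted semigroup algebra `ℓ₁(S, ω)`; its norm and its convolution product are
introduced below. -/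
def WeightedL1 {S : Type*} [Semigroup S] (ω : SemigroupWeight S) : Type _ :=
  ↥(weightedL1Submodule ω)

namespace WeightedL1

variable {S : Type*} [Semigroup S] {ω : SemigroupWeight S}

instance : AddCommGroup (WeightedL1 ω) := inferInstanceAs (AddCommGroup ↥(weightedL1Submodule ω))

instance : Module ℂ (WeightedL1 ω) := inferInstanceAs (Module ℂ ↥(weightedL1Submodule ω))

instance : CoeFun (WeightedL1 ω) (fun _ => S → ℂ) := ⟨fun f => f.1⟩

theorem ext {f g : WeightedL1 ω} (h : ∀ s, f s = g s) : f = g := Subtype.ext (funext h)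

theorem summable (f : WeightedL1 ω) : Summable fun s => ‖f s‖ * ω s := f.2

theorem add_apply (f g : WeightedL1 ω) (s : S) : (f + g) s = f s + g s := rfl

theorem smul_apply (c : ℂ) (f : WeightedL1 ω) (s : S) : (c • f) s = c * f s := rfl

/-- The norm `‖f‖ = ∑ s, |f s| ω s`. -/
instance : Norm (WeightedL1 ω) := ⟨fun f => ∑' s, ‖f s‖ * ω s⟩

theorem norm_def (f : WeightedL1 ω) : ‖f‖ = ∑' s, ‖f s‖ * ω s := rfl

theorem term_nonneg (f : WeightedL1 ω) (s : S) : 0 ≤ ‖f s‖ * ω s :=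
  mul_nonneg (norm_nonneg _) (ω.pos s).le

theorem normCore : NormedSpace.Core ℂ (WeightedL1 ω) where
  norm_nonneg f := tsum_nonneg f.term_nonneg
  norm_smul c f := by
    rw [norm_def, norm_def, ← tsum_mul_left]
    exact tsum_congr fun s => by rw [smul_apply, norm_mul, mul_assoc]
  norm_triangle f g := by
    rw [norm_def, norm_def, norm_def, ← f.summable.tsum_add g.summable]
    refine (f + g).summable.tsum_le_tsum (fun s => ?_) (f.summable.add g.summable)
    rw [← add_mul, add_apply]
    exact mul_le_mul_of_nonneg_right (norm_add_le _ _) (ω.pos s).le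
  norm_eq_zero_iff f := by
    rw [norm_def]
    constructor
    · intro h
      have h0 := (hasSum_zero_iff_of_nonneg f.term_nonneg).1 (h ▸ f.summable.hasSum)
      refine ext fun s => ?_
      have hs := congrFun h0 s
      rcases mul_eq_zero.1 hs with h1 | h1
      · exact norm_eq_zero.1 h1
      · exact absurd h1 (ω.pos s).ne'
    · rintro rfl
      have : ∀ s : S, ‖(0 : WeightedL1 ω) s‖ * ω s = 0 := fun s => by
        rw [show (0 : WeightedL1 ω) s = 0 from rfl]; simp
      simp [this]

instance : NormedAddCommGroup (WeightedL1 ω) := NormedAddCommGroup.ofCore normCore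

instance : NormedSpace ℂ (WeightedL1 ω) := NormedSpace.ofCore normCore

theorem norm_eq (f : WeightedL1 ω) : ‖f‖ = ∑' s, ‖f s‖ * ω s := rfl

theorem summable_prod (f g : WeightedL1 ω) :
    Summable fun p : S × S => (‖f p.1‖ * ω p.1) * (‖g p.2‖ * ω p.2) :=
  f.summable.mul_of_nonneg g.summable f.term_nonneg g.term_nonneg

theorem summable_prod_weight (f g : WeightedL1 ω) :
    Summable fun p : S × S => ‖f p.1 * g p.2‖ * ω (p.1 * p.2) := by
  refine Summable.of_nonneg_of_le (fun p => mul_nonneg (norm_nonneg _) (ω.pos _).le)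
    (fun p => ?_) (summable_prod f g)
  calc ‖f p.1 * g p.2‖ * ω (p.1 * p.2)
      ≤ ‖f p.1 * g p.2‖ * (ω p.1 * ω p.2) :=
        mul_le_mul_of_nonneg_left (ω.submul _ _) (norm_nonneg _)
    _ = _ := by rw [norm_mul]; ring

theorem summable_sigma_weight (f g : WeightedL1 ω) :
    Summable fun x : (Σ s : S, {p : S × S // p.1 * p.2 = s}) =>
      ‖f x.2.1.1 * g x.2.1.2‖ * ω x.1 := by
  have h := (Equiv.sigmaFiberEquiv fun p : S × S => p.1 * p.2).summable_iff.2
    (summable_prod_weight f g)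
  refine h.congr fun x => ?_
  obtain ⟨s, p, rfl⟩ := x
  rfl

theorem summable_fiber_norm (f g : WeightedL1 ω) (s : S) :
    Summable fun p : {p : S × S // p.1 * p.2 = s} => ‖f p.1.1 * g p.1.2‖ := by
  have h := (summable_sigma_weight f g).sigma_factor s
  exact (summable_mul_right_iff (ω.pos s).ne').1 h

theorem summable_fiber (f g : WeightedL1 ω) (s : S) :
    Summable fun p : {p : S × S // p.1 * p.2 = s} => f p.1.1 * g p.1.2 :=
  (summable_fiber_norm f g s).of_norm

theorem norm_conv_le (f g : WeightedL1 ω) (s : S) :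
    ‖∑' p : {p : S × S // p.1 * p.2 = s}, f p.1.1 * g p.1.2‖ * ω s ≤
      ∑' p : {p : S × S // p.1 * p.2 = s}, ‖f p.1.1 * g p.1.2‖ * ω s := by
  rw [tsum_mul_right]
  exact mul_le_mul_of_nonneg_right (norm_tsum_le_tsum_norm (summable_fiber_norm f g s))
    (ω.pos s).le

/-- The convolution product `(f * g) s = ∑_{u v = s} f u * g v`. -/
instance : Mul (WeightedL1 ω) where
  mul f g := ⟨fun s => ∑' p : {p : S × S // p.1 * p.2 = s}, f p.1.1 * g p.1.2,
    Summable.of_nonneg_of_le (fun s => mul_nonneg (norm_nonneg _) (ω.pos s).le)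
      (norm_conv_le f g) (summable_sigma_weight f g).sigma⟩

theorem mul_apply (f g : WeightedL1 ω) (s : S) :
    (f * g) s = ∑' p : {p : S × S // p.1 * p.2 = s}, f p.1.1 * g p.1.2 := rfl

theorem norm_mul_le' (f g : WeightedL1 ω) : ‖f * g‖ ≤ ‖f‖ * ‖g‖ := by
  have e : ∑' x : (Σ s : S, {p : S × S // p.1 * p.2 = s}), ‖f x.2.1.1 * g x.2.1.2‖ * ω x.1 =
      ∑' p : S × S, ‖f p.1 * g p.2‖ * ω (p.1 * p.2) := by
    rw [← (Equiv.sigmaFiberEquiv fun p : S × S => p.1 * p.2).tsum_eq]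
    refine tsum_congr fun x => ?_
    obtain ⟨s, p, rfl⟩ := x
    rfl
  calc ‖f * g‖ = ∑' s, ‖(f * g) s‖ * ω s := rfl
    _ ≤ ∑' s, ∑' p : {p : S × S // p.1 * p.2 = s}, ‖f p.1.1 * g p.1.2‖ * ω s :=
        (f * g).summable.tsum_le_tsum (norm_conv_le f g) (summable_sigma_weight f g).sigma
    _ = ∑' p : S × S, ‖f p.1 * g p.2‖ * ω (p.1 * p.2) := by
        rw [← (summable_sigma_weight f g).tsum_sigma, e]
    _ ≤ ∑' p : S × S, (‖f p.1‖ * ω p.1) * (‖g p.2‖ * ω p.2) := by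
        refine (summable_prod_weight f g).tsum_le_tsum (fun p => ?_) (summable_prod f g)
        calc ‖f p.1 * g p.2‖ * ω (p.1 * p.2)
            ≤ ‖f p.1 * g p.2‖ * (ω p.1 * ω p.2) :=
              mul_le_mul_of_nonneg_left (ω.submul _ _) (norm_nonneg _)
          _ = _ := by rw [norm_mul]; ring
    _ = ‖f‖ * ‖g‖ := (f.summable.tsum_mul_tsum g.summable (summable_prod f g)).symm

/-- Pairing a convolution with a function dominated by a multiple of the weight. -/
theorem tsum_mul_conv (f g : WeightedL1 ω) (φ : S → ℂ) (C : ℝ) (hφ : ∀ s, ‖φ s‖ ≤ C * ω s) :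
    ∑' s, (f * g) s * φ s = ∑' u, f u * ∑' v, g v * φ (u * v) := by
  have hs : Summable fun p : S × S => f p.1 * g p.2 * φ (p.1 * p.2) := by
    refine Summable.of_norm_bounded ((summable_prod_weight f g).mul_left C) fun p => ?_
    rw [norm_mul]
    calc ‖f p.1 * g p.2‖ * ‖φ (p.1 * p.2)‖ ≤ ‖f p.1 * g p.2‖ * (C * ω (p.1 * p.2)) :=
          mul_le_mul_of_nonneg_left (hφ _) (norm_nonneg _)
      _ = _ := by ring
  have hσ := (Equiv.sigmaFiberEquiv fun p : S × S => p.1 * p.2).summable_iff.2 hs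
  calc ∑' s, (f * g) s * φ s
      = ∑' s, ∑' p : {p : S × S // p.1 * p.2 = s}, f p.1.1 * g p.1.2 * φ (p.1.1 * p.1.2) := by
        refine tsum_congr fun s => ?_
        rw [mul_apply, ← tsum_mul_right]
        exact tsum_congr fun p => by rw [p.2]
    _ = ∑' p : S × S, f p.1 * g p.2 * φ (p.1 * p.2) := by
        rw [← (Equiv.sigmaFiberEquiv fun p : S × S => p.1 * p.2).tsum_eq]
        exact hσ.tsum_sigma.symm
    _ = ∑' u, ∑' v, f u * g v * φ (u * v) := hs.tsum_prod
    _ = _ := by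
        refine tsum_congr fun u => ?_
        rw [← tsum_mul_left]
        exact tsum_congr fun v => by rw [mul_assoc]

theorem mul_assoc' (f g h : WeightedL1 ω) : f * g * h = f * (g * h) := by
  classical
  refine ext fun s => ?_
  let δ : S → ℂ := fun t => if t = s then 1 else 0
  have hδ : ∀ t, ‖δ t‖ ≤ (ω s)⁻¹ * ω t := fun t => by
    by_cases ht : t = s
    · subst ht; simp [δ, inv_mul_cancel₀ (ω.pos t).ne']
    · simp only [δ, ht, if_false, norm_zero]
      exact mul_nonneg (inv_nonneg.2 (ω.pos s).le) (ω.pos t).le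
  have hev : ∀ k : WeightedL1 ω, k s = ∑' t, k t * δ t := fun k => by
    simp [δ]
  have hC : 0 ≤ (ω s)⁻¹ := inv_nonneg.2 (ω.pos s).le
  have hδ1 : ∀ u, ‖∑' v, h v * δ (u * v)‖ ≤ ((ω s)⁻¹ * ‖h‖) * ω u := fun u => by
    have hb : ∀ v, ‖h v * δ (u * v)‖ ≤ ((ω s)⁻¹ * ω u) * (‖h v‖ * ω v) := fun v => by
      rw [norm_mul]
      calc ‖h v‖ * ‖δ (u * v)‖ ≤ ‖h v‖ * ((ω s)⁻¹ * (ω u * ω v)) :=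
            mul_le_mul_of_nonneg_left
              ((hδ _).trans (mul_le_mul_of_nonneg_left (ω.submul _ _) hC)) (norm_nonneg _)
        _ = _ := by ring
    refine (tsum_of_norm_bounded (h.summable.mul_left _).hasSum hb).trans_eq ?_
    rw [tsum_mul_left, norm_eq]; ring
  have hδ2 : ∀ u t, ‖δ (u * t)‖ ≤ ((ω s)⁻¹ * ω u) * ω t := fun u t =>
    ((hδ _).trans (mul_le_mul_of_nonneg_left (ω.submul _ _) hC)).trans_eq (by ring)
  rw [hev, hev, tsum_mul_conv _ _ δ _ hδ, tsum_mul_conv f (g * h) δ _ hδ,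
    tsum_mul_conv f g _ _ hδ1]
  refine tsum_congr fun a => ?_
  rw [tsum_mul_conv g h (fun t => δ (a * t)) _ (hδ2 a)]
  simp only [mul_assoc]

instance : NonUnitalNormedRing (WeightedL1 ω) :=
  { (inferInstance : NormedAddCommGroup (WeightedL1 ω)) with
    mul := (· * ·)
    mul_assoc := mul_assoc'
    left_distrib := fun f g h => ext fun s => by
      rw [add_apply, mul_apply, mul_apply, mul_apply,
        ← (summable_fiber f g s).tsum_add (summable_fiber f h s)]
      exact tsum_congr fun p => by rw [add_apply, mul_add]
    right_distrib := fun f g h => ext fun s => by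
      rw [add_apply, mul_apply, mul_apply, mul_apply,
        ← (summable_fiber f h s).tsum_add (summable_fiber g h s)]
      exact tsum_congr fun p => by rw [add_apply, add_mul]
    zero_mul := fun f => ext fun s => by
      rw [mul_apply]
      exact (tsum_congr fun p => zero_mul _).trans tsum_zero
    mul_zero := fun f => ext fun s => by
      rw [mul_apply]
      exact (tsum_congr fun p => mul_zero _).trans tsum_zero
    norm_mul_le := norm_mul_le' }

instance : IsScalarTower ℂ (WeightedL1 ω) (WeightedL1 ω) :=
  ⟨fun c f g => ext fun s => by
    rw [smul_eq_mul, smul_eq_mul, smul_apply, mul_apply, mul_apply, ← tsum_mul_left]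
    exact tsum_congr fun p => by rw [smul_apply, mul_assoc]⟩

instance : SMulCommClass ℂ (WeightedL1 ω) (WeightedL1 ω) :=
  ⟨fun c f g => ext fun s => by
    rw [smul_eq_mul, smul_eq_mul, smul_apply, mul_apply, mul_apply, ← tsum_mul_left]
    exact tsum_congr fun p => by rw [smul_apply]; ring⟩

end WeightedL1

end

/-!
Arens regularity of `ℓ₁(S, ω)` is a statement about point masses: it holds if and only if, for every
functional `f`, the kernel `(x, y) ↦ f (δ_x δ_y)`, with `δ_x` of norm one, has equal iterated limits
along any two ultrafilters (`WeightedL1.isArensRegular_iff`). One direction takes weak-star limits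
of point masses in the bidual. The other is Grothendieck's double limit theorem for `ℓ₁`: an element
of the bidual is a finitely additive complex measure, pointwise limits of the kernel pass under it
by a form of dominated convergence (`WeightedL1.tendsto_bidual_of_hasDoubleLimits`), and Goldstine's
theorem finishes the argument (`WeightedL1.bidual_comm_of_hasDoubleLimits`).

For the trivial weight, indicator functions of subsets `Z` are functionals, so regularity of `ℓ₁(S)`
forbids sequences with `x i * y j ∈ Z` exactly for `i ≤ j`. This property, `HasNoSeparatedProducts`,
mentions no weight and passes to homomorphic images by lifting the sequences. It forces the product
to degenerate: along two ultrafilters, in both orders, `x * y` depends on `x` only or on `y` only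
(`HasNoSeparatedProducts.dichotomy`); otherwise a greedy choice of `x₀, y₀, x₁, y₁, …` yields
separated products. Then, for any weight, the kernel `f (δ_{x * y}) ω (x * y) / (ω x * ω y)` is, in
both orders, a product of a function of `x` and a function of `y`, and for such a product
the two iterated limits agree (`eq_of_eventually_eq_mul`).
-/

open Filter Topology

/-! ### Ultrafilter limits in duals and biduals -/

theorem Ultrafilter.exists_tendsto_of_norm_le {I E : Type*} [NormedAddCommGroup E] [ProperSpace E]
    (W : Ultrafilter I) {a : I → E} {C : ℝ} (h : ∀ i, ‖a i‖ ≤ C) :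
    ∃ l, Tendsto a W (𝓝 l) := by
  obtain ⟨l, -, hl⟩ := (isCompact_closedBall (0 : E) C).ultrafilter_le_nhds (W.map a) (by
    rw [le_principal_iff]
    exact Filter.mem_map.2 (Filter.univ_mem' fun i => by simpa using h i))
  exact ⟨l, hl⟩

/-- Banach–Alaoglu for ultrafilters: a bounded family of functionals has a weak-star limit. -/
theorem Ultrafilter.exists_tendsto_dual {I E : Type*} [NormedAddCommGroup E] [NormedSpace ℂ E]
    (W : Ultrafilter I) {F : I → E →L[ℂ] ℂ} {C : ℝ} (h : ∀ i, ‖F i‖ ≤ C) :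
    ∃ g : E →L[ℂ] ℂ, ∀ e, Tendsto (fun i => F i e) W (𝓝 (g e)) := by
  obtain ⟨g, -, hg⟩ := (WeakDual.isCompact_closedBall (𝕜 := ℂ) (0 : StrongDual ℂ E) C
    ).ultrafilter_le_nhds (W.map fun i => StrongDual.toWeakDual (F i)) (by
      rw [le_principal_iff]
      exact Filter.mem_map.2 (Filter.univ_mem' fun i => by simpa using h i))
  refine ⟨WeakDual.toStrongDual g, fun e => ?_⟩
  exact ((WeakDual.eval_continuous e).tendsto g).comp hg

/-- Helly's theorem: on finitely many functionals, an element `n` of the bidual is approximated by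
points of the ball of radius `‖n‖`. -/
theorem mem_closure_image_ball_of_bidual {E ι : Type*} [NormedAddCommGroup E] [NormedSpace ℂ E]
    [Fintype ι] (n : (E →L[ℂ] ℂ) →L[ℂ] ℂ) (f : ι → E →L[ℂ] ℂ) :
    (fun i => n (f i)) ∈ closure ((fun (a : E) i => f i a) '' Metric.closedBall 0 ‖n‖) := by
  classical
  by_contra hv
  have hconv : Convex ℝ (closure ((fun (a : E) i => f i a) '' Metric.closedBall 0 ‖n‖)) := by
    refine Convex.closure ?_
    exact (convex_closedBall (0 : E) ‖n‖).linear_image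
      ((LinearMap.pi fun i => (f i : E →ₗ[ℂ] ℂ)).restrictScalars ℝ)
  obtain ⟨L, u, hL, hu⟩ := RCLike.geometric_hahn_banach_closed_point (𝕜 := ℂ) hconv
    isClosed_closure hv
  have hexp : ∀ w : ι → ℂ, L w = ∑ i, w i * L (Pi.single i 1) := fun w => by
    conv_lhs => rw [← Finset.univ_sum_single w, map_sum]
    refine Finset.sum_congr rfl fun i _ => ?_
    rw [← smul_eq_mul, ← map_smul]
    congr 1
    ext j
    by_cases hj : j = i
    · subst hj; simp
    · simp [hj]
  -- the separating functional on `ι → ℂ` pulls back to a functional `h` on `E` with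
  -- `‖n‖ * ‖h‖ ≤ u < re (n h)`
  let h : E →L[ℂ] ℂ := ∑ i, L (Pi.single i 1) • f i
  have hh : ∀ a, h a = L fun i => f i a := fun a => by
    rw [hexp]
    simp only [h, sum_apply, smul_apply, smul_eq_mul]
    exact Finset.sum_congr rfl fun i _ => mul_comm _ _
  have hn : n h = L fun i => n (f i) := by
    rw [hexp]
    simp only [h, map_sum, map_smul, smul_eq_mul]
    exact Finset.sum_congr rfl fun i _ => mul_comm _ _
  have hball : ∀ a : E, ‖a‖ ≤ ‖n‖ → RCLike.re (h a) < u := fun a ha => by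
    rw [hh]
    exact hL _ (subset_closure ⟨a, by simpa using ha, rfl⟩)
  have hu0 : 0 < u := by simpa using hball 0 (by rw [norm_zero]; exact norm_nonneg n)
  have hbound : ∀ a : E, ‖a‖ ≤ ‖n‖ → ‖h a‖ ≤ u := fun a ha => by
    obtain ⟨c, hc, hca⟩ := RCLike.exists_norm_eq_mul_self (h a)
    have := hball (c • a) (by rw [norm_smul, hc, one_mul]; exact ha)
    rw [map_smul, smul_eq_mul, ← hca] at this
    simpa using this.le
  have hnh : ‖n‖ * ‖h‖ ≤ u := by
    rcases (norm_nonneg n).eq_or_lt with h0 | h0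
    · rw [← h0, zero_mul]; exact hu0.le
    rw [mul_comm, ← le_div_iff₀ h0]
    refine ContinuousLinearMap.opNorm_le_of_unit_norm (𝕜 := ℂ) (by positivity) fun a ha => ?_
    have := hbound ((‖n‖ : ℂ) • a) (by
      rw [norm_smul, ha, Complex.norm_real, Real.norm_of_nonneg (norm_nonneg n), mul_one])
    rw [map_smul, norm_smul, Complex.norm_real, Real.norm_of_nonneg (norm_nonneg n)] at this
    rwa [le_div_iff₀ h0, mul_comm]
  have h1 : RCLike.re (n h) ≤ u :=
    ((RCLike.re_le_norm _).trans (n.le_opNorm h)).trans hnh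
  rw [hn] at h1
  exact absurd hu (not_lt.2 h1)

/-- Goldstine's theorem: every element of the bidual is a weak-star limit of a bounded family of
points, along an ultrafilter. -/
theorem exists_ultrafilter_tendsto_bidual {E : Type*} [NormedAddCommGroup E] [NormedSpace ℂ E]
    (n : (E →L[ℂ] ℂ) →L[ℂ] ℂ) :
    ∃ W : Ultrafilter (Metric.closedBall (0 : E) ‖n‖),
      ∀ f : E →L[ℂ] ℂ, Tendsto (fun a : Metric.closedBall (0 : E) ‖n‖ => f a) W (𝓝 (n f)) := by
  let e : Metric.closedBall (0 : E) ‖n‖ → (E →L[ℂ] ℂ) → ℂ := fun a f => f a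
  have hmem : (fun f => n f) ∈ closure (Set.range e) := by
    rw [mem_closure_iff_nhds_basis' (nhds_pi (a := fun f => n f) ▸
      hasBasis_pi fun f => Metric.nhds_basis_ball)]
    rintro ⟨s, r⟩ ⟨hs, hr⟩
    have := hs.fintype
    have hc := mem_closure_image_ball_of_bidual n (fun f : s => (f : E →L[ℂ] ℂ))
    rw [mem_closure_iff_nhds_basis' (nhds_pi (a := fun f : s => n f) ▸
      hasBasis_pi fun f => Metric.nhds_basis_ball)] at hc
    obtain ⟨_, hb, a, ha, rfl⟩ := hc ⟨Set.univ, fun f => r f⟩ ⟨Set.finite_univ, fun f _ => hr f f.2⟩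
    exact ⟨e ⟨a, ha⟩, fun f hf => hb ⟨f, hf⟩ trivial, ⟨a, ha⟩, rfl⟩
  have hne : (comap e (𝓝 fun f => n f)).NeBot := by
    rw [comap_neBot_iff_frequently]
    exact (mem_closure_iff_frequently.1 hmem)
  refine ⟨Ultrafilter.of (comap e (𝓝 fun f => n f)), fun f => ?_⟩
  have h : Tendsto e (Ultrafilter.of (comap e (𝓝 fun f => n f)) : Filter _) (𝓝 fun f => n f) :=
    tendsto_comap.mono_left (Ultrafilter.of_le _)
  exact tendsto_pi_nhds.1 h f

/-! ### Iterated limits of kernels -/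

/-- The iterated limits of `κ` along any two ultrafilters agree. The limits are passed as variables
with `Tendsto` hypotheses; for bounded `κ` they always exist. -/
def HasDoubleLimits {X Y : Type*} (κ : X → Y → ℂ) : Prop :=
  ∀ (U : Ultrafilter X) (V : Ultrafilter Y) (a : Y → ℂ) (b : X → ℂ) (l l' : ℂ),
    (∀ y, Tendsto (fun x => κ x y) U (𝓝 (a y))) → (∀ x, Tendsto (κ x) V (𝓝 (b x))) →
    Tendsto a V (𝓝 l) → Tendsto b U (𝓝 l') → l = l'

/-- A bounded kernel with double limits cannot be far from a function of the second variable on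
one side of the diagonal of a sequence, and close to it on the other side. -/
theorem HasDoubleLimits.false_of_separated {X Y : Type*} {κ : X → Y → ℂ} (h : HasDoubleLimits κ)
    {C : ℝ} (hκ : ∀ x y, ‖κ x y‖ ≤ C) {x : ℕ → X} {y : ℕ → Y} {γ : ℕ → ℂ} (hγ : ∀ j, ‖γ j‖ ≤ C)
    {η : ℝ} (hη : 0 < η) (hup : ∀ i j, i ≤ j → η ≤ ‖κ (x i) (y j) - γ j‖)
    (hlo : ∀ i j, j < i → ‖κ (x i) (y j) - γ j‖ ≤ η / 3) : False := by
  let W : Ultrafilter ℕ := hyperfilter ℕ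
  have hW : (W : Filter ℕ) ≤ atTop := Nat.hyperfilter_le_atTop
  choose a ha using fun t => (W.map x).exists_tendsto_of_norm_le fun s => hκ s t
  choose b hb using fun s => (W.map y).exists_tendsto_of_norm_le (hκ s)
  have haC : ∀ t, ‖a t‖ ≤ C := fun t =>
    le_of_tendsto (ha t).norm (Filter.univ_mem' fun s => hκ s t)
  have hbC : ∀ s, ‖b s‖ ≤ C := fun s =>
    le_of_tendsto (hb s).norm (Filter.univ_mem' (hκ s))
  obtain ⟨l, hl⟩ := (W.map y).exists_tendsto_of_norm_le haC
  obtain ⟨l', hl'⟩ := (W.map x).exists_tendsto_of_norm_le hbC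
  obtain ⟨c, hc⟩ := W.exists_tendsto_of_norm_le hγ
  have hll := h _ _ a b l l' ha hb hl hl'
  have h1 : ‖l - c‖ ≤ η / 3 := by
    refine le_of_tendsto (Tendsto.sub (f := fun j => a (y j)) hl hc).norm
      (Filter.univ_mem' fun j => ?_)
    refine le_of_tendsto (Tendsto.sub_const (f := fun i => κ (x i) (y j)) (ha (y j)) (γ j)).norm ?_
    exact hW ((eventually_gt_atTop j).mono fun i hi => hlo i j hi)
  have h2 : η ≤ ‖l' - c‖ := by
    refine ge_of_tendsto (Tendsto.sub_const (f := fun i => b (x i)) hl' c).norm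
      (Filter.univ_mem' fun i => ?_)
    refine ge_of_tendsto (Tendsto.sub (f := fun j => κ (x i) (y j)) (hb (x i)) hc).norm ?_
    exact hW ((eventually_ge_atTop i).mono fun j hj => hup i j hj)
  rw [hll] at h1
  linarith

/-- A kernel which is a product `G x * h y` in both iterated senses has equal iterated limits. -/
theorem eq_of_eventually_eq_mul {X Y : Type*} {κ : X → Y → ℂ} {U : Ultrafilter X}
    {V : Ultrafilter Y} {G : X → ℂ} {h : Y → ℂ}
    (hUV : ∀ᶠ x in U, ∀ᶠ y in V, κ x y = G x * h y)
    (hVU : ∀ᶠ y in V, ∀ᶠ x in U, κ x y = G x * h y) {a : Y → ℂ} {b : X → ℂ} {l l' : ℂ}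
    (ha : ∀ y, Tendsto (fun x => κ x y) U (𝓝 (a y))) (hb : ∀ x, Tendsto (κ x) V (𝓝 (b x)))
    (hl : Tendsto a V (𝓝 l)) (hl' : Tendsto b U (𝓝 l')) : l = l' := by
  have ha' : ∀ᶠ y in V, Tendsto (fun x => G x * h y) U (𝓝 (a y)) :=
    hVU.mono fun y hy => (ha y).congr' hy
  have hb' : ∀ᶠ x in U, Tendsto (fun y => G x * h y) V (𝓝 (b x)) :=
    hUV.mono fun x hx => (hb x).congr' hx
  have hzero : (∀ᶠ y in V, a y = 0) → (∀ᶠ x in U, b x = 0) → l = l' := fun h1 h2 => by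
    rw [tendsto_nhds_unique (hl.congr' h1) tendsto_const_nhds,
      tendsto_nhds_unique (hl'.congr' h2) tendsto_const_nhds]
  rcases U.em (fun x => G x = 0) with hG | hG
  · refine hzero (ha'.mono fun y hy => ?_) ((hG.and hb').mono fun x hx => ?_)
    · exact tendsto_nhds_unique hy (tendsto_const_nhds.congr' (hG.mono fun x hx => by simp [hx]))
    · exact tendsto_nhds_unique hx.2 (by simp [hx.1])
  rcases V.em (fun y => h y = 0) with hh | hh
  · refine hzero ((hh.and ha').mono fun y hy => ?_) (hb'.mono fun x hx => ?_)
    · exact tendsto_nhds_unique hy.2 (by simp [hy.1])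
    · exact tendsto_nhds_unique hx (tendsto_const_nhds.congr' (hh.mono fun x hx => by simp [hx]))
  obtain ⟨y, hy, hy0⟩ := (ha'.and hh).exists
  obtain ⟨x, hx, hx0⟩ := (hb'.and hG).exists
  have hG' : Tendsto G U (𝓝 (a y / h y)) := by
    simpa [mul_div_assoc, div_self hy0] using hy.div_const (h y)
  have hh' : Tendsto h V (𝓝 (b x / G x)) := by
    simpa [mul_div_cancel_left₀ _ hx0] using hx.div_const (G x)
  have e1 : ∀ᶠ y' in V, a y' = a y / h y * h y' := ha'.mono fun y' hy' =>
    tendsto_nhds_unique hy' (hG'.mul_const _)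
  have e2 : ∀ᶠ x' in U, b x' = G x' * (b x / G x) := hb'.mono fun x' hx' =>
    tendsto_nhds_unique hx' (hh'.const_mul _)
  rw [tendsto_nhds_unique (hl.congr' e1) (hh'.const_mul _),
    tendsto_nhds_unique (hl'.congr' e2) (hG'.mul_const _)]

/-! ### Interleaved sequences and finitely additive measures -/

/-- Greedy choice of two interleaved sequences `x₀, y₀, x₁, y₁, …`: the state `s` records what the
later choices have to respect, `lo` governs pairs with `y` chosen first, `up` those with `x` chosen
first. The invariant may refer to the finite sets of points chosen so far, but not to their
order. -/
theorem exists_interleaved_seq {X Y σ : Type*} [Preorder σ] {Inv : Finset X → Finset Y → σ → Prop}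
    {lo up : σ → X → Y → Prop} (hlo : ∀ s s' x y, s ≤ s' → lo s x y → lo s' x y)
    [DecidableEq X] [DecidableEq Y]
    {s₀ : σ} (h0 : Inv ∅ ∅ s₀)
    (hx : ∀ A B s, Inv A B s → ∃ x s', s ≤ s' ∧ Inv (insert x A) B s' ∧ ∀ y ∈ B, lo s' x y)
    (hy : ∀ A B s, Inv A B s → ∃ y s', s ≤ s' ∧ Inv A (insert y B) s' ∧ ∀ x ∈ A, up s' x y) :
    ∃ (x : ℕ → X) (y : ℕ → Y) (s : ℕ → σ), Monotone s ∧ (∀ n, ∃ A B, Inv A B (s n)) ∧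
      (∀ i j, i ≤ j → up (s j) (x i) (y j)) ∧ ∀ i j, j < i → lo (s i) (x i) (y j) := by
  let St := {p : Finset X × Finset Y × σ // Inv p.1 p.2.1 p.2.2}
  have step : ∀ p : St, ∃ (x : X) (y : Y) (q : St), p.1.2.2 ≤ q.1.2.2 ∧
      q.1.1 = insert x p.1.1 ∧ q.1.2.1 = insert y p.1.2.1 ∧ (∀ y' ∈ p.1.2.1, lo q.1.2.2 x y') ∧
      ∀ x' ∈ q.1.1, up q.1.2.2 x' y := by
    rintro ⟨⟨A, B, s⟩, hp⟩
    obtain ⟨x, s', hs, hI, hl⟩ := hx A B s hp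
    obtain ⟨y, s'', hs', hI', hu⟩ := hy _ _ _ hI
    exact ⟨x, y, ⟨⟨insert x A, insert y B, s''⟩, hI'⟩, hs.trans hs', rfl, rfl,
      fun y' hy' => hlo _ _ _ _ hs' (hl y' hy'), hu⟩
  choose fx fy nx h1 h2 h3 h4 h5 using step
  let st : ℕ → St := fun n => nx^[n] ⟨⟨∅, ∅, s₀⟩, h0⟩
  have hst : ∀ n, st (n + 1) = nx (st n) := fun n => Function.iterate_succ_apply' _ _ _
  have hmono : Monotone fun n => (st n).1.2.2 :=
    monotone_nat_of_le_succ fun n => by rw [hst]; exact h1 _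
  have hxm : ∀ i j, i ≤ j → fx (st i) ∈ (st (j + 1)).1.1 := fun i j hij => by
    induction j, hij using Nat.le_induction with
    | base => rw [hst, h2]; exact Finset.mem_insert_self _ _
    | succ j _ ih => rw [hst, h2]; exact Finset.mem_insert_of_mem ih
  have hym : ∀ i j, j < i → fy (st j) ∈ (st i).1.2.1 := fun i j hij => by
    induction i, hij using Nat.le_induction with
    | base => rw [hst, h3]; exact Finset.mem_insert_self _ _
    | succ j _ ih => rw [hst, h3]; exact Finset.mem_insert_of_mem ih
  refine ⟨fun n => fx (st n), fun n => fy (st n), fun n => (st (n + 1)).1.2.2,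
    fun i j hij => hmono (Nat.succ_le_succ hij), fun n => ⟨_, _, (st (n + 1)).2⟩,
    fun i j hij => ?_, fun i j hij => ?_⟩
  · have := hxm i j hij
    simp only [hst] at this ⊢
    exact h5 _ _ this
  · have := hym i j hij
    simp only [hst i]
    exact h4 _ _ this

/-- A finite, finitely additive, nonnegative set function. -/
structure IsCharge {Y : Type*} (v : Set Y → ℝ) : Prop where
  nonneg : ∀ E, 0 ≤ v E
  union : ∀ E F, Disjoint E F → v (E ∪ F) = v E + v F

namespace IsCharge
variable {Y I : Type*} {v : Set Y → ℝ}

theorem inter_add_diff (hv : IsCharge v) (E F : Set Y) : v (E ∩ F) + v (E \ F) = v E := by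
  rw [← hv.union _ _ (Set.disjoint_sdiff_right.mono_left Set.inter_subset_right),
    Set.inter_union_sdiff]

theorem mono (hv : IsCharge v) {E F : Set Y} (h : E ⊆ F) : v E ≤ v F := by
  have := hv.inter_add_diff F E
  rw [Set.inter_eq_self_of_subset_right h] at this
  linarith [hv.nonneg (F \ E)]

theorem union_le (hv : IsCharge v) (E F : Set Y) : v (E ∪ F) ≤ v E + v F := by
  have h := hv.union E (F \ E) Set.disjoint_sdiff_right
  rw [Set.union_sdiff_self] at h
  linarith [hv.mono (Set.sdiff_subset : F \ E ⊆ F)]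

theorem inter_biUnion_le (hv : IsCharge v) (F : Set Y) (E : ℕ → Set Y) (δ : ℝ) (n : ℕ)
    (h : ∀ k < n, v (F ∩ E k) ≤ δ) : v (F ∩ ⋃ k < n, E k) ≤ n * δ := by
  induction n with
  | zero =>
    have h0 := hv.union ∅ ∅ (by simp)
    simp only [Set.union_self] at h0
    simp
    linarith
  | succ n ih =>
    rw [Set.biUnion_lt_succ, Set.inter_union_distrib_left]
    have := hv.union_le (F ∩ ⋃ k < n, E k) (F ∩ E n)
    have h1 := ih fun k hk => h k (hk.trans n.lt_succ_self)
    have h2 := h n n.lt_succ_self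
    push_cast
    linarith

/-- Sets of charge at least `δ`, indexed by an ultrafilter, overlap substantially: otherwise
arbitrarily many of them would be almost disjoint. -/
theorem eventually_exists_le_inter (hv : IsCharge v) {W : Ultrafilter I} {E : I → Set Y} {δ : ℝ}
    (hδ : 0 < δ) (hE : ∀ᶠ i in W, δ ≤ v (E i)) :
    ∀ᶠ i in W, ∃ δ' > 0, ∀ᶠ j in W, δ' ≤ v (E i ∩ E j) := by
  by_contra hcon
  rw [← Ultrafilter.eventually_not] at hcon
  obtain ⟨N, hN⟩ := exists_nat_gt (2 * v Set.univ / δ)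
  have hN0 : (0 : ℝ) < N := lt_of_le_of_lt (by have := hv.nonneg Set.univ; positivity) hN
  have hsmall : ∀ᶠ i in W, ∀ᶠ j in W, v (E i ∩ E j) ≤ δ / (2 * N) := hcon.mono fun i hi => by
    by_contra hc
    rw [← Ultrafilter.eventually_not] at hc
    exact hi ⟨δ / (2 * N), by positivity, hc.mono fun j hj => (not_le.1 hj).le⟩
  obtain ⟨f, hf, hff⟩ := exists_seq_of_forall_finset_exists
    (fun i => δ ≤ v (E i) ∧ ∀ᶠ j in W, v (E i ∩ E j) ≤ δ / (2 * N))
    (fun i j => v (E i ∩ E j) ≤ δ / (2 * N)) fun s hs =>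
      ((hE.and hsmall).and ((Finset.eventually_all s).2 fun i hi => (hs i hi).2)).exists
  have hsum : ∀ n ≤ N, n * (δ / 2) ≤ v (⋃ k < n, E (f k)) := by
    intro n
    induction n with
    | zero => intro _; simpa using hv.nonneg _
    | succ n ih =>
      intro hn
      have h1 := hv.inter_biUnion_le (E (f n)) (fun k => E (f k)) (δ / (2 * N)) n
        fun k hk => by rw [Set.inter_comm]; exact hff k n hk
      have h2 := hv.inter_add_diff (E (f n)) (⋃ k < n, E (f k))
      have h3 := hv.union (⋃ k < n, E (f k)) (E (f n) \ ⋃ k < n, E (f k))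
        Set.disjoint_sdiff_right
      rw [Set.union_sdiff_self] at h3
      rw [Set.biUnion_lt_succ, h3]
      have h4 : (n : ℝ) * (δ / (2 * N)) ≤ δ / 2 := by
        have : (n : ℝ) ≤ N := by exact_mod_cast (Nat.le_of_succ_le hn)
        calc (n : ℝ) * (δ / (2 * N)) ≤ N * (δ / (2 * N)) := by gcongr
          _ = δ / 2 := by field_simp
      have h5 := ih (Nat.le_of_succ_le hn)
      have h6 := (hf n).1
      push_cast
      linarith
  have h1 := (hsum N le_rfl).trans (hv.mono (Set.subset_univ _))
  rw [div_lt_iff₀ hδ] at hN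
  linarith

/-- Let `E i` have charge at least `δ` along `W`, and let `q · y` hold along `W` for each point `y`.
Then there are sequences with `y l ∈ E (i k)` for `k ≤ l` and `q (i k) (y l)` for `l < k`. The
first property replaces a point common to infinitely many `E i`, which a merely finitely additive
`v` does not provide. -/
theorem exists_seq_mem (hv : IsCharge v) {W : Ultrafilter I} {E : I → Set Y} {δ : ℝ}
    (hδ : 0 < δ) (hE : ∀ᶠ i in W, δ ≤ v (E i)) {q : I → Y → Prop} (hq : ∀ y, ∀ᶠ i in W, q i y) :
    ∃ (i : ℕ → I) (y : ℕ → Y), (∀ k l, k ≤ l → y l ∈ E (i k)) ∧ ∀ k l, l < k → q (i k) (y l) := by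
  classical
  obtain ⟨i, y, -, -, -, hup, hlo⟩ := exists_interleaved_seq (X := I) (Y := Y) (σ := Unit)
    -- the sets chosen so far still meet the later ones in sets of charge bounded below
    (Inv := fun A _ _ => ∃ δ > 0, ∀ᶠ j in W, δ ≤ v ((⋂ i ∈ A, E i) ∩ E j))
    (lo := fun _ i y => q i y) (up := fun _ i y => y ∈ E i)
    (fun _ _ _ _ _ h => h) (s₀ := ())
    ⟨δ, hδ, by simpa using hE⟩ (by
      rintro A B - ⟨δ₁, hδ₁, h⟩
      obtain ⟨i, ⟨δ₂, hδ₂, h2⟩, h3⟩ := ((hv.eventually_exists_le_inter hδ₁ h).and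
        ((Finset.eventually_all B).2 fun y _ => hq y)).exists
      refine ⟨i, (), le_rfl, ⟨δ₂, hδ₂, h2.mono fun j hj => hj.trans (hv.mono ?_)⟩, h3⟩
      intro y hy
      simp only [Set.mem_inter_iff, Set.mem_iInter, Finset.mem_insert] at hy ⊢
      refine ⟨?_, hy.2.2⟩
      rintro k (rfl | hk)
      · exact hy.1.2
      · exact hy.1.1 k hk) (by
      rintro A B - ⟨δ₁, hδ₁, h⟩
      obtain ⟨j, hj⟩ := h.exists
      obtain ⟨y, hy⟩ : ((⋂ i ∈ A, E i) ∩ E j).Nonempty := by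
        by_contra hne
        rw [Set.not_nonempty_iff_eq_empty] at hne
        have h0 := hv.union ∅ ∅ (by simp)
        simp only [Set.union_self] at h0
        rw [hne] at hj
        linarith
      exact ⟨y, (), le_rfl, ⟨δ₁, hδ₁, h⟩, fun x hx => by
        have := hy.1
        simp only [Set.mem_iInter] at this
        exact this x hx⟩)
  exact ⟨i, y, hup, hlo⟩

end IsCharge

/-! ### Point masses and the dual of a weighted semigroup algebra -/

noncomputable section
namespace WeightedL1

variable {S : Type*} [Semigroup S] {ω : SemigroupWeight S}

/-- Evaluation at a point, as an additive map. -/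
def evalHom (ω : SemigroupWeight S) (t : S) : WeightedL1 ω →+ ℂ where
  toFun f := f t
  map_zero' := rfl
  map_add' _ _ := rfl

theorem sum_apply {ι : Type*} (F : Finset ι) (f : ι → WeightedL1 ω) (t : S) :
    (∑ i ∈ F, f i) t = ∑ i ∈ F, f i t :=
  map_sum (evalHom ω t) f F

open Classical in
/-- The point mass at `s`, normalized to have norm one. -/
def dirac (ω : SemigroupWeight S) (s : S) : WeightedL1 ω :=
  ⟨fun t => if t = s then ((ω s : ℝ) : ℂ)⁻¹ else 0,
    summable_of_ne_finset_zero (s := {s}) fun t ht => by simp_all⟩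

open Classical in
theorem dirac_apply (s t : S) :
    dirac ω s t = if t = s then ((ω s : ℝ) : ℂ)⁻¹ else 0 := rfl

theorem weight_ne_zero (s : S) : ((ω s : ℝ) : ℂ) ≠ 0 :=
  Complex.ofReal_ne_zero.2 (ω.pos s).ne'

theorem norm_dirac (s : S) : ‖dirac ω s‖ = 1 := by
  rw [norm_eq, tsum_eq_single s fun t ht => by simp [dirac_apply, ht]]
  simp [dirac_apply, abs_of_pos (ω.pos s), (ω.pos s).ne']

theorem hasSum_dirac (a : WeightedL1 ω) :
    HasSum (fun s => (a s * ω s) • dirac ω s) a := by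
  classical
  rw [HasSum, SummationFilter.unconditional_filter, tendsto_iff_norm_sub_tendsto_zero]
  refine (tendsto_tsum_compl_atTop_zero fun s => ‖a s‖ * ω s).congr fun F => ?_
  rw [norm_eq]
  refine Eq.trans (tsum_subtype {s | s ∉ F} fun s => ‖a s‖ * ω s) (tsum_congr fun t => ?_)
  have h : (∑ s ∈ F, (a s * ω s) • dirac ω s - a) t
      = (∑ s ∈ F, if t = s then a t else 0) - a t := by
    refine (map_sub (evalHom ω t) _ _).trans (congrArg (· - a t) ((sum_apply _ _ t).trans ?_))
    refine Finset.sum_congr rfl fun s _ => ?_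
    rw [smul_apply, dirac_apply]
    split_ifs with h
    · subst h
      rw [mul_assoc, mul_inv_cancel₀ (weight_ne_zero _), mul_one]
    · simp
  rw [h]
  by_cases ht : t ∈ F <;> simp [ht]

theorem dirac_mul_dirac (x y : S) :
    dirac ω x * dirac ω y = ((ω (x * y) / (ω x * ω y) : ℝ) : ℂ) • dirac ω (x * y) := by
  classical
  refine ext fun t => ?_
  rw [mul_apply, smul_apply, dirac_apply]
  split_ifs with h
  · rw [tsum_eq_single ⟨(x, y), h.symm⟩]
    · simp only [dirac_apply, if_true]
      have h1 := weight_ne_zero (ω := ω) x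
      have h2 := weight_ne_zero (ω := ω) y
      have h3 := weight_ne_zero (ω := ω) (x * y)
      push_cast
      field_simp
    · rintro ⟨⟨u, v⟩, huv⟩ hne
      by_cases hu : u = x
      · have hv : v ≠ y := fun hv => hne (by subst hu; subst hv; rfl)
        simp [dirac_apply, hv]
      · simp [dirac_apply, hu]
  · rw [mul_zero]
    refine (tsum_congr fun p => ?_).trans tsum_zero
    obtain ⟨⟨u, v⟩, huv⟩ := p
    by_cases hu : u = x
    · have hv : v ≠ y := fun hv => h (by subst hu; subst hv; exact huv.symm)
      simp [dirac_apply, hv]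
    · simp [dirac_apply, hu]

theorem norm_apply_dirac_le (f : WeightedL1 ω →L[ℂ] ℂ) (s : S) : ‖f (dirac ω s)‖ ≤ ‖f‖ := by
  simpa [norm_dirac] using f.le_opNorm (dirac ω s)

theorem opNorm_le_of_dirac (f : WeightedL1 ω →L[ℂ] ℂ) {C : ℝ} (hC : 0 ≤ C)
    (h : ∀ s, ‖f (dirac ω s)‖ ≤ C) : ‖f‖ ≤ C := by
  refine f.opNorm_le_bound hC fun a => ?_
  have hf := (hasSum_dirac a).mapL f
  rw [← hf.tsum_eq, norm_eq, ← tsum_mul_left]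
  refine tsum_of_norm_bounded (a.summable.mul_left C).hasSum fun s => ?_
  rw [map_smul, norm_smul, norm_mul, Complex.norm_real, Real.norm_of_nonneg (ω.pos s).le, mul_comm]
  exact mul_le_mul_of_nonneg_right (h s) (a.term_nonneg s)

theorem dual_ext {f g : WeightedL1 ω →L[ℂ] ℂ} (h : ∀ s, f (dirac ω s) = g (dirac ω s)) : f = g := by
  rw [← sub_eq_zero, ← norm_le_zero_iff]
  exact opNorm_le_of_dirac _ le_rfl fun s => by simp [h]

/-- Every bounded function on `S` gives the values of a functional on the normalized point masses of
`ℓ₁(S, ω)`. -/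
theorem exists_dual_dirac_eq (h : S → ℂ) {C : ℝ} (hC : ∀ s, ‖h s‖ ≤ C) :
    ∃ f : WeightedL1 ω →L[ℂ] ℂ, ∀ s, f (dirac ω s) = h s := by
  classical
  have hb : ∀ (a : WeightedL1 ω) s, ‖a s * ω s * h s‖ ≤ C * (‖a s‖ * ω s) := fun a s => by
    rw [norm_mul, norm_mul, Complex.norm_real, Real.norm_of_nonneg (ω.pos s).le, mul_comm]
    exact mul_le_mul_of_nonneg_right (hC s) (a.term_nonneg s)
  have hs : ∀ a : WeightedL1 ω, Summable fun s => a s * ω s * h s := fun a =>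
    Summable.of_norm_bounded (a.summable.mul_left C) (hb a)
  let L : WeightedL1 ω →ₗ[ℂ] ℂ :=
    { toFun := fun a => ∑' s, a s * ω s * h s
      map_add' := fun a b => by
        rw [← (hs a).tsum_add (hs b)]
        exact tsum_congr fun s => by rw [add_apply]; ring
      map_smul' := fun c a => by
        rw [RingHom.id_apply, smul_eq_mul, ← tsum_mul_left]
        exact tsum_congr fun s => by rw [smul_apply]; ring }
  refine ⟨L.mkContinuous C fun a => ?_, fun s => ?_⟩
  · rw [norm_eq, ← tsum_mul_left]
    exact tsum_of_norm_bounded (a.summable.mul_left C).hasSum (hb a)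
  · change ∑' t, dirac ω s t * ω t * h t = h s
    rw [tsum_eq_single s fun t ht => by simp [dirac_apply, ht]]
    rw [dirac_apply, if_pos rfl, inv_mul_cancel₀ (weight_ne_zero s), one_mul]

/-- The functional whose values on the normalized point masses of `E` are those of `f`, and which
vanishes on the other ones. -/
theorem exists_restrict (f : WeightedL1 ω →L[ℂ] ℂ) (E : Set S) :
    ∃ g : WeightedL1 ω →L[ℂ] ℂ, ∀ s, g (dirac ω s) = E.indicator (fun s => f (dirac ω s)) s :=
  exists_dual_dirac_eq (C := ‖f‖) _ fun s =>
    (norm_indicator_le_norm_self _ _).trans (norm_apply_dirac_le f s)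

/-! ### The bidual of a weighted semigroup algebra -/

/-- The values at which the supremum defining the total variation of `n` on `E` is taken. -/
def variationSet (n : (WeightedL1 ω →L[ℂ] ℂ) →L[ℂ] ℂ) (E : Set S) : Set ℝ :=
  {r | ∃ f : WeightedL1 ω →L[ℂ] ℂ, (∀ s, ‖f (dirac ω s)‖ ≤ E.indicator 1 s) ∧ ‖n f‖ = r}

/-- The total variation of an element `n` of the bidual of `ℓ₁(S, ω)`, seen as a finitely additive
complex measure on `S`. -/
def variation (n : (WeightedL1 ω →L[ℂ] ℂ) →L[ℂ] ℂ) (E : Set S) : ℝ :=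
  sSup (variationSet n E)

variable (n : (WeightedL1 ω →L[ℂ] ℂ) →L[ℂ] ℂ)

theorem bddAbove_variationSet (E : Set S) : BddAbove (variationSet n E) := by
  refine ⟨‖n‖, ?_⟩
  rintro _ ⟨f, hf, rfl⟩
  refine (n.le_opNorm f).trans (mul_le_of_le_one_right (norm_nonneg n) ?_)
  refine opNorm_le_of_dirac f zero_le_one fun s => (hf s).trans ?_
  exact Set.indicator_le_self' (fun _ _ => zero_le_one) s

theorem norm_le_variation {f : WeightedL1 ω →L[ℂ] ℂ} {E : Set S}
    (hf : ∀ s, ‖f (dirac ω s)‖ ≤ E.indicator 1 s) : ‖n f‖ ≤ variation n E :=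
  le_csSup (bddAbove_variationSet n E) ⟨f, hf, rfl⟩

theorem variation_le {E : Set S} {C : ℝ}
    (h : ∀ f : WeightedL1 ω →L[ℂ] ℂ, (∀ s, ‖f (dirac ω s)‖ ≤ E.indicator 1 s) → ‖n f‖ ≤ C) :
    variation n E ≤ C := by
  refine csSup_le ⟨_, 0, fun s => ?_, rfl⟩ ?_
  · rw [_root_.zero_apply, norm_zero]
    exact Set.indicator_nonneg (fun _ _ => zero_le_one) s
  · rintro _ ⟨f, hf, rfl⟩
    exact h f hf

theorem isCharge_variation : IsCharge (variation n) where
  nonneg E := (norm_nonneg _).trans (norm_le_variation n (f := 0) fun s => by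
    rw [_root_.zero_apply, norm_zero]
    exact Set.indicator_nonneg (fun _ _ => zero_le_one) s)
  union E F hEF := by
    refine le_antisymm (variation_le n fun f hf => ?_) ?_
    · obtain ⟨g, hg⟩ := exists_restrict f E
      obtain ⟨k, hk⟩ := exists_restrict f F
      have hfgk : f = g + k := dual_ext fun s => by
        rw [_root_.add_apply, hg, hk]
        have hs := hf s
        by_cases h1 : s ∈ E
        · simp [h1, Set.disjoint_left.1 hEF h1]
        · by_cases h2 : s ∈ F
          · simp [h1, h2]
          · simpa [h1, h2] using hs
      rw [hfgk, map_add]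
      refine (norm_add_le _ _).trans (add_le_add (norm_le_variation n fun s => ?_)
        (norm_le_variation n fun s => ?_))
      · rw [hg]
        have hs := hf s
        by_cases h1 : s ∈ E
        · simpa [h1] using hs
        · simp [h1]
      · rw [hk]
        have hs := hf s
        by_cases h1 : s ∈ F
        · simpa [h1] using hs
        · simp [h1]
    · rw [← le_sub_iff_add_le]
      refine variation_le n fun f hf => ?_
      rw [le_sub_comm]
      refine variation_le n fun g hg => ?_
      rw [le_sub_iff_add_le']
      -- rotating both functionals makes their values under `n` add up without cancellation
      obtain ⟨c, hc, hcf⟩ := RCLike.exists_norm_eq_mul_self (n f)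
      obtain ⟨d, hd, hdg⟩ := RCLike.exists_norm_eq_mul_self (n g)
      have hsum : ‖n (c • f + d • g)‖ = ‖n f‖ + ‖n g‖ := by
        rw [map_add, map_smul, map_smul, smul_eq_mul, smul_eq_mul, ← hcf, ← hdg]
        exact_mod_cast Real.norm_of_nonneg (add_nonneg (norm_nonneg (n f)) (norm_nonneg (n g)))
      rw [← hsum]
      refine norm_le_variation n fun s => ?_
      have h1 : ‖(c • f + d • g) (dirac ω s)‖ ≤ ‖f (dirac ω s)‖ + ‖g (dirac ω s)‖ := by
        refine (norm_add_le _ _).trans_eq ?_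
        change ‖c • f (dirac ω s)‖ + ‖d • g (dirac ω s)‖ = _
        rw [norm_smul, norm_smul, hc, hd, one_mul, one_mul]
      refine (h1.trans (add_le_add (hf s) (hg s))).trans_eq ?_
      rw [Set.indicator_union_of_disjoint hEF]

/-- Dominated convergence for elements of the bidual: if a bounded family of functionals has double
limits on point masses, its pointwise ultrafilter limits are weak limits. Otherwise the sets where
`F i` is far from its limit `g` have total variation bounded below along `W`, and a separated pair
of sequences can be chosen. -/
theorem tendsto_bidual_of_hasDoubleLimits {I : Type*} {F : I → WeightedL1 ω →L[ℂ] ℂ} {C : ℝ}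
    (hF : ∀ i, ‖F i‖ ≤ C) (hd : HasDoubleLimits fun i s => F i (dirac ω s)) (W : Ultrafilter I)
    {g : WeightedL1 ω →L[ℂ] ℂ}
    (hg : ∀ s, Tendsto (fun i => F i (dirac ω s)) W (𝓝 (g (dirac ω s)))) :
    Tendsto (fun i => n (F i)) W (𝓝 (n g)) := by
  by_contra hcon
  have hC : ∀ i s, ‖F i (dirac ω s)‖ ≤ C := fun i s => (norm_apply_dirac_le _ s).trans (hF i)
  have hgC : ∀ s, ‖g (dirac ω s)‖ ≤ C := fun s =>
    le_of_tendsto (hg s).norm (Filter.univ_mem' fun i => hC i s)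
  obtain ⟨ε, hε, hfr⟩ : ∃ ε > 0, ∀ᶠ i in W, ε ≤ ‖n (F i - g)‖ := by
    rw [Metric.tendsto_nhds] at hcon
    push Not at hcon
    obtain ⟨ε, hε, h⟩ := hcon
    refine ⟨ε, hε, h.mono fun i hi => ?_⟩
    rw [map_sub, ← dist_eq_norm]
    exact hi
  let η : ℝ := ε / (2 * (‖n‖ + 1))
  have hn1 : 0 < ‖n‖ + 1 := add_pos_of_nonneg_of_pos (norm_nonneg n) one_pos
  have hη : 0 < η := by positivity
  -- off `E i` the difference `F i - g` is too small to account for more than half of `ε`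
  let E : I → Set S := fun i => {s | η ≤ ‖(F i - g) (dirac ω s)‖}
  -- a bound for `F i - g`, made positive to be divided by
  let K : ℝ := 2 * |C| + 1
  have hK : 0 < K := by positivity
  have hE : ∀ᶠ i in W, ε / (2 * K) ≤ variation n (E i) := hfr.mono fun i hi => by
    obtain ⟨p, hp⟩ := exists_restrict (F i - g) (E i)
    obtain ⟨q, hq⟩ := exists_restrict (F i - g) (E i)ᶜ
    have hpq : F i - g = p + q := dual_ext fun s => by
      rw [_root_.add_apply, hp, hq, Set.indicator_self_add_compl_apply]
    have hq' : ‖n q‖ ≤ ε / 2 := by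
      refine (n.le_opNorm q).trans ?_
      have : ‖q‖ ≤ η := opNorm_le_of_dirac q hη.le fun s => by
        rw [hq]
        by_cases hs : s ∈ E i
        · simpa [hs] using hη.le
        · rw [Set.indicator_of_mem (show s ∈ (E i)ᶜ from hs)]
          exact (not_le.1 hs).le
      calc ‖n‖ * ‖q‖ ≤ (‖n‖ + 1) * η := by
            exact mul_le_mul (le_add_of_nonneg_right zero_le_one) this (norm_nonneg q) hn1.le
        _ = ε / 2 := by simp only [η]; field_simp
    have hp' : ‖n (((K⁻¹ : ℝ) : ℂ) • p)‖ ≤ variation n (E i) := norm_le_variation n fun s => by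
      rw [_root_.smul_apply, norm_smul, Complex.norm_real, Real.norm_of_nonneg (by positivity), hp]
      by_cases hs : s ∈ E i
      · rw [Set.indicator_of_mem hs, Set.indicator_of_mem hs, Pi.one_apply, inv_mul_le_one₀ hK]
        have h1 := norm_sub_le (F i (dirac ω s)) (g (dirac ω s))
        have h2 := hC i s
        have h3 := hgC s
        have h4 := le_abs_self C
        rw [_root_.sub_apply]
        simp only [K]
        linarith
      · simp [hs]
    rw [map_smul, norm_smul, Complex.norm_real, Real.norm_of_nonneg (by positivity)] at hp'
    refine le_trans ?_ hp'
    rw [hpq, map_add] at hi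
    have h5 : ε / 2 ≤ ‖n p‖ := by linarith [norm_add_le (n p) (n q)]
    calc ε / (2 * K) = K⁻¹ * (ε / 2) := by field_simp
      _ ≤ K⁻¹ * ‖n p‖ := by gcongr
  obtain ⟨i, s, hup, hlo⟩ := (isCharge_variation n).exists_seq_mem (by positivity) hE
    (q := fun i s => ‖F i (dirac ω s) - g (dirac ω s)‖ ≤ η / 3) fun s => by
      have h0 : Tendsto (fun i => ‖F i (dirac ω s) - g (dirac ω s)‖) W (𝓝 0) :=
        tendsto_iff_norm_sub_tendsto_zero.1 (hg s)
      exact h0.eventually_le_const (by positivity)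
  exact hd.false_of_separated hC (fun j => hgC (s j)) hη hup hlo

/-- The two iterated extensions to the bidual of a bounded bilinear form on `ℓ₁(S, ω)` agree if it
has double limits on point masses. -/
theorem bidual_comm_of_hasDoubleLimits (B : WeightedL1 ω →L[ℂ] WeightedL1 ω →L[ℂ] ℂ)
    (hB : HasDoubleLimits fun x y => B (dirac ω x) (dirac ω y))
    (m n : (WeightedL1 ω →L[ℂ] ℂ) →L[ℂ] ℂ) : m (n.comp B) = n (m.comp B.flip) := by
  have hbd : ∀ x, ‖B (dirac ω x)‖ ≤ ‖B‖ := fun x => by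
    simpa [norm_dirac] using B.le_opNorm (dirac ω x)
  obtain ⟨W, hW⟩ := exists_ultrafilter_tendsto_bidual n
  have hbd' : ∀ a : Metric.closedBall (0 : WeightedL1 ω) ‖n‖, ‖B.flip a‖ ≤ ‖B‖ * ‖n‖ := fun a => by
    refine (B.flip.le_opNorm a).trans ?_
    rw [ContinuousLinearMap.opNorm_flip]
    exact mul_le_mul_of_nonneg_left (mem_closedBall_zero_iff.1 a.2) (norm_nonneg B)
  -- one variable is first extended from point masses to the ball of `ℓ₁(S, ω)`, in which `n` is
  -- approximated
  have hd : HasDoubleLimits fun (a : Metric.closedBall (0 : WeightedL1 ω) ‖n‖) x =>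
      B.flip a (dirac ω x) := by
    intro W' U p q l l' hp hq hl hl'
    obtain ⟨n', hn'⟩ := W'.exists_tendsto_dual (C := ‖n‖)
      (F := fun a : Metric.closedBall (0 : WeightedL1 ω) ‖n‖ =>
        NormedSpace.inclusionInDoubleDual ℂ (WeightedL1 ω) a)
      fun a => (NormedSpace.double_dual_bound ℂ _ _).trans (mem_closedBall_zero_iff.1 a.2)
    obtain ⟨g, hg⟩ := U.exists_tendsto_dual hbd
    have hp' : ∀ x, p x = n' (B (dirac ω x)) := fun x =>
      tendsto_nhds_unique (hp x) (hn' (B (dirac ω x)))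
    have hq' : ∀ a, q a = g a := fun a => tendsto_nhds_unique (hq a) (hg a)
    have h1 : l = n' g := by
      refine tendsto_nhds_unique hl ?_
      rw [show p = fun x => n' (B (dirac ω x)) from funext hp']
      exact tendsto_bidual_of_hasDoubleLimits n' hbd hB U fun s => hg _
    have h2 : l' = n' g := by
      refine tendsto_nhds_unique hl' ?_
      rw [show q = fun a : Metric.closedBall (0 : WeightedL1 ω) ‖n‖ => g a from funext hq']
      exact hn' g
    rw [h1, h2]
  have h1 := tendsto_bidual_of_hasDoubleLimits m hbd' hd W (g := n.comp B)
    fun s => hW (B (dirac ω s))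
  exact tendsto_nhds_unique h1 (hW (m.comp B.flip))

/-! ### Arens regularity on point masses -/

/-- The bilinear form `(a, b) ↦ f (a * b)`. -/
def mulForm (f : WeightedL1 ω →L[ℂ] ℂ) : WeightedL1 ω →L[ℂ] WeightedL1 ω →L[ℂ] ℂ :=
  arensAdjoint (ContinuousLinearMap.mul ℂ (WeightedL1 ω)) f

theorem firstArensProduct_apply (m n : (WeightedL1 ω →L[ℂ] ℂ) →L[ℂ] ℂ) (f : WeightedL1 ω →L[ℂ] ℂ) :
    firstArensProduct (WeightedL1 ω) m n f = m (n.comp (mulForm f)) := rfl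

theorem secondArensProduct_apply (m n : (WeightedL1 ω →L[ℂ] ℂ) →L[ℂ] ℂ)
    (f : WeightedL1 ω →L[ℂ] ℂ) :
    secondArensProduct (WeightedL1 ω) m n f = n (m.comp (mulForm f).flip) := rfl

/-- Arens regularity of `ℓ₁(S, ω)` is a double limit condition on point masses. -/
theorem isArensRegular_iff : IsArensRegular (WeightedL1 ω) ↔
    ∀ f : WeightedL1 ω →L[ℂ] ℂ, HasDoubleLimits fun x y => f (dirac ω x * dirac ω y) := by
  constructor
  · intro h f U V p q l l' hp hq hl hl'
    have hbd : ∀ s, ‖NormedSpace.inclusionInDoubleDual ℂ (WeightedL1 ω) (dirac ω s)‖ ≤ 1 :=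
      fun s => (NormedSpace.double_dual_bound ℂ _ _).trans (norm_dirac s).le
    obtain ⟨m, hm⟩ := U.exists_tendsto_dual hbd
    obtain ⟨n, hn⟩ := V.exists_tendsto_dual hbd
    have h1 := DFunLike.congr_fun (h m n) f
    rw [firstArensProduct_apply, secondArensProduct_apply] at h1
    have hq' : ∀ x, q x = n (mulForm f (dirac ω x)) := fun x =>
      tendsto_nhds_unique (hq x) (hn _)
    have hp' : ∀ y, p y = m ((mulForm f).flip (dirac ω y)) := fun y =>
      tendsto_nhds_unique (hp y) (hm _)
    have h2 : l' = m (n.comp (mulForm f)) := by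
      refine tendsto_nhds_unique hl' ?_
      rw [show q = fun x => n (mulForm f (dirac ω x)) from funext hq']
      exact hm _
    have h3 : l = n (m.comp (mulForm f).flip) := by
      refine tendsto_nhds_unique hl ?_
      rw [show p = fun y => m ((mulForm f).flip (dirac ω y)) from funext hp']
      exact hn _
    rw [h2, h3, h1]
  · intro h m n
    ext f
    rw [firstArensProduct_apply, secondArensProduct_apply]
    exact bidual_comm_of_hasDoubleLimits _ (h f) m n

end WeightedL1
end

/-! ### Products in the semigroup -/

/-- No subset of `T` contains exactly the products `x i * y j` with `i ≤ j`, for sequences `x` and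
`y`. -/
def HasNoSeparatedProducts (T : Type*) [Mul T] : Prop :=
  ∀ (x y : ℕ → T) (Z : Set T), (∀ i j, i ≤ j → x i * y j ∈ Z) → ∃ i j, j < i ∧ x i * y j ∈ Z

/-- The indicator function of a set of products would be a functional whose kernel on point masses
has iterated limits `1` and `0`. -/
theorem hasNoSeparatedProducts_of_isArensRegular {S : Type*} [Semigroup S]
    (h : IsArensRegular (WeightedL1 (trivialWeight S))) : HasNoSeparatedProducts S := by
  classical
  intro x y Z hup
  by_contra! hlo
  have hC : ∀ s, ‖Z.indicator (1 : S → ℂ) s‖ ≤ 1 := fun s => by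
    by_cases hs : s ∈ Z <;> simp [hs]
  obtain ⟨f, hf⟩ := WeightedL1.exists_dual_dirac_eq (ω := trivialWeight S) _ hC
  have hf' : ∀ s t, f (WeightedL1.dirac _ s * WeightedL1.dirac _ t) =
      Z.indicator (1 : S → ℂ) (s * t) := fun s t => by
    rw [WeightedL1.dirac_mul_dirac, map_smul, hf]
    simp [trivialWeight]
  have hd := WeightedL1.isArensRegular_iff.1 h f
  simp only [hf'] at hd
  refine hd.false_of_separated (C := 1) (fun s t => hC _) (x := x) (y := y) (γ := 0) (by simp)
    one_pos (fun i j hij => ?_) fun i j hij => ?_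
  · simp [hup i j hij]
  · simp [hlo i j hij]

theorem HasNoSeparatedProducts.of_surjective {S T : Type*} [Mul S] [Mul T] (ψ : S →ₙ* T)
    (hψ : Function.Surjective ψ) (h : HasNoSeparatedProducts S) : HasNoSeparatedProducts T := by
  intro x y Z hup
  choose x' hx' using fun i => hψ (x i)
  choose y' hy' using fun i => hψ (y i)
  obtain ⟨i, j, hij, hZ⟩ := h x' y' (ψ ⁻¹' Z) fun i j hij => by simpa [hx', hy'] using hup i j hij
  exact ⟨i, j, hij, by simpa [hx', hy'] using hZ⟩

namespace HasNoSeparatedProducts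
variable {T : Type*} [Mul T]

/-- If `x * y` lies in `Z` for the iterated ultrafilter in one order, then also in the other. -/
theorem eventually_mem (h : HasNoSeparatedProducts T) {U V : Ultrafilter T} {Z : Set T}
    (hZ : ∀ᶠ x in U, ∀ᶠ y in V, x * y ∈ Z) : ∀ᶠ y in V, ∀ᶠ x in U, x * y ∈ Z := by
  classical
  by_contra hcon
  rw [← Ultrafilter.eventually_not] at hcon
  replace hcon := hcon.mono fun y hy => Ultrafilter.eventually_not.2 hy
  obtain ⟨x, y, -, -, -, hup, hlo⟩ := exists_interleaved_seq (σ := Unit)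
    (Inv := fun A B _ => (∀ x ∈ A, ∀ᶠ y in V, x * y ∈ Z) ∧ ∀ y ∈ B, ∀ᶠ x in U, x * y ∉ Z)
    (lo := fun _ x y => x * y ∉ Z) (up := fun _ x y => x * y ∈ Z)
    (fun _ _ _ _ _ h => h) (s₀ := ()) (by simp)
    (fun A B _ hI => by
      obtain ⟨x, hx, hx'⟩ := (hZ.and ((Finset.eventually_all B).2 hI.2)).exists
      exact ⟨x, (), le_rfl, ⟨(Finset.forall_mem_insert _ _ _).2 ⟨hx, hI.1⟩, hI.2⟩, hx'⟩)
    (fun A B _ hI => by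
      obtain ⟨y, hy, hy'⟩ := (hcon.and ((Finset.eventually_all A).2 hI.1)).exists
      exact ⟨y, (), le_rfl, ⟨hI.1, (Finset.forall_mem_insert _ _ _).2 ⟨hy, hI.2⟩⟩, hy'⟩)
  obtain ⟨i, j, hij, hmem⟩ := h x y Z hup
  exact hlo i j hij hmem

/-- The product degenerates along two ultrafilters `U` and `V`. Either `x * ·` is constant along `V`
for `U`-almost all `x`, and its value there is `x * y` for `V`-almost all `y`; or the same holds
with the variables exchanged. -/
theorem dichotomy (h : HasNoSeparatedProducts T) (U V : Ultrafilter T) :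
    (∀ᶠ y : T in V, ∀ᶠ x : T in U, ∀ᶠ y' : T in V, x * y' = x * y) ∨
      (∀ᶠ x : T in U, ∀ᶠ y : T in V, ∀ᶠ x' : T in U, x' * y = x * y) := by
  classical
  by_contra! hcon
  obtain ⟨hD, hE⟩ := hcon
  -- `D x` and `E y` contain the constant value of `x * ·` and `· * y`, if there is one
  let D : T → Set T := fun x => {c | ∀ᶠ y in V, x * y = c}
  let E : T → Set T := fun y => {c | ∀ᶠ x in U, x * y = c}
  have hDfin : ∀ x, (D x).Finite := fun x => Set.Subsingleton.finite fun c hc d hd => by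
    obtain ⟨y, hy, hy'⟩ := (Filter.Eventually.and hc hd).exists
    exact hy.symm.trans hy'
  have hEfin : ∀ y, (E y).Finite := fun y => Set.Subsingleton.finite fun c hc d hd => by
    obtain ⟨x, hx, hx'⟩ := (Filter.Eventually.and hc hd).exists
    exact hx.symm.trans hx'
  have hD' : ∀ᶠ y in V, ∀ᶠ x in U, x * y ∉ D x := hD.mono fun y hy =>
    hy.mono fun x hx hc =>
      let ⟨_, h1, h2⟩ := (hx.and hc).exists
      h1 h2
  have hE' : ∀ᶠ x in U, ∀ᶠ y in V, x * y ∉ E y := hE.mono fun x hx =>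
    hx.mono fun y hy hc =>
      let ⟨_, h1, h2⟩ := (hy.and hc).exists
      h1 h2
  -- a value `c` common to almost all `D x` would be the value of `x * y` in both orders
  have hDc : ∀ c, ∀ᶠ x in U, c ∉ D x := fun c => by
    by_contra hc
    rw [← Ultrafilter.eventually_not] at hc
    replace hc : ∀ᶠ x in U, c ∈ D x := hc.mono fun x hx => not_not.1 hx
    obtain ⟨y, hy, hy'⟩ := (hD'.and (h.eventually_mem (Z := {c}) hc)).exists
    obtain ⟨x, hx, hx', hx''⟩ := (hc.and (hy.and hy')).exists
    exact hx' (Set.eq_of_mem_singleton hx'' ▸ hx)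
  have hEc : ∀ c, ∀ᶠ y in V, c ∉ E y := fun c => by
    by_contra hc
    rw [← Ultrafilter.eventually_not] at hc
    replace hc : ∀ᶠ y in V, c ∈ E y := hc.mono fun y hy => not_not.1 hy
    -- `eventually_mem` goes from the order `U, V` to `V, U`; its converse uses complements
    have hc' : ∀ᶠ x in U, ∀ᶠ y in V, x * y = c := by
      by_contra hn
      rw [← Ultrafilter.eventually_not] at hn
      obtain ⟨y, hy, hy'⟩ := (hc.and (h.eventually_mem (Z := {c}ᶜ)
        (hn.mono fun x hx => Ultrafilter.eventually_not.2 hx))).exists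
      obtain ⟨x, hx, hx'⟩ := (Filter.Eventually.and hy hy').exists
      exact hx' hx
    obtain ⟨x, hx, hx'⟩ := (hE'.and hc').exists
    obtain ⟨y, hy, hy', hy''⟩ := (hc.and (hx.and hx')).exists
    exact hy' (hy''.symm ▸ hy)
  -- the state `(P, Q)` consists of the values committed above and below the diagonal; it includes
  -- the constant values of the chosen points, so that later products are either committed or new
  obtain ⟨x, y, s, hs, hI, hup, hlo⟩ := exists_interleaved_seq (σ := Set T × Set T)
    (Inv := fun A B s => s.1.Finite ∧ s.2.Finite ∧ Disjoint s.1 s.2 ∧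
      (∀ x ∈ A, D x ⊆ s.1 ∧ ∀ᶠ y in V, x * y ∉ E y) ∧
      ∀ y ∈ B, E y ⊆ s.2 ∧ ∀ᶠ x in U, x * y ∉ D x)
    (lo := fun s x y => x * y ∈ s.2) (up := fun s x y => x * y ∈ s.1)
    (fun _ _ _ _ hss hmem => (Prod.le_def.1 hss).2 hmem) (s₀ := (∅, ∅)) (by simp)
    (by
      rintro A B ⟨P, Q⟩ ⟨hP, hQ, hPQ, hA, hB⟩
      have h1 : ∀ᶠ x in U, ∀ c ∈ Q, c ∉ D x := (eventually_all_finite hQ).2 fun c _ => hDc c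
      have h2 : ∀ᶠ x in U, ∀ y ∈ B, ∀ c ∈ P, x * y ≠ c := (Finset.eventually_all B).2 fun y hy =>
        (eventually_all_finite hP).2 fun c hc => Ultrafilter.eventually_not.2 fun hcE =>
          Set.disjoint_left.1 hPQ hc ((hB y hy).1 hcE)
      have h3 : ∀ᶠ x in U, ∀ y ∈ B, x * y ∉ D x :=
        (Finset.eventually_all B).2 fun y hy => (hB y hy).2
      obtain ⟨x, hx1, hx2, hx3, hx4⟩ := (h1.and (h2.and (h3.and hE'))).exists
      refine ⟨x, (P ∪ D x, Q ∪ (fun y => x * y) '' (B : Set T)),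
        ⟨Set.subset_union_left, Set.subset_union_left⟩,
        ⟨hP.union (hDfin x), hQ.union (B.finite_toSet.image _), ?_, ?_, fun y hy =>
          ⟨(hB y hy).1.trans Set.subset_union_left, (hB y hy).2⟩⟩,
        fun y hy => Or.inr ⟨y, hy, rfl⟩⟩
      · rw [Set.disjoint_left]
        rintro c (hc | hc) (hc' | ⟨y, hy, rfl⟩)
        · exact Set.disjoint_left.1 hPQ hc hc'
        · exact hx2 y hy _ hc rfl
        · exact hx1 c hc' hc
        · exact hx3 y hy hc
      · refine (Finset.forall_mem_insert _ _ _).2 ⟨⟨Set.subset_union_right, hx4⟩, fun x' hx' =>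
          ⟨(hA x' hx').1.trans Set.subset_union_left, (hA x' hx').2⟩⟩)
    (by
      rintro A B ⟨P, Q⟩ ⟨hP, hQ, hPQ, hA, hB⟩
      have h1 : ∀ᶠ y in V, ∀ c ∈ P, c ∉ E y := (eventually_all_finite hP).2 fun c _ => hEc c
      have h2 : ∀ᶠ y in V, ∀ x ∈ A, ∀ c ∈ Q, x * y ≠ c := (Finset.eventually_all A).2 fun x hx =>
        (eventually_all_finite hQ).2 fun c hc => Ultrafilter.eventually_not.2 fun hcD =>
          Set.disjoint_left.1 hPQ ((hA x hx).1 hcD) hc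
      have h3 : ∀ᶠ y in V, ∀ x ∈ A, x * y ∉ E y :=
        (Finset.eventually_all A).2 fun x hx => (hA x hx).2
      obtain ⟨y, hy1, hy2, hy3, hy4⟩ := (h1.and (h2.and (h3.and hD'))).exists
      refine ⟨y, (P ∪ (fun x => x * y) '' (A : Set T), Q ∪ E y),
        ⟨Set.subset_union_left, Set.subset_union_left⟩,
        ⟨hP.union (A.finite_toSet.image _), hQ.union (hEfin y), ?_, fun x hx =>
          ⟨(hA x hx).1.trans Set.subset_union_left, (hA x hx).2⟩, ?_⟩,
        fun x hx => Or.inr ⟨x, hx, rfl⟩⟩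
      · rw [Set.disjoint_right]
        rintro c (hc | hc) (hc' | ⟨x, hx, rfl⟩)
        · exact Set.disjoint_left.1 hPQ hc' hc
        · exact hy2 x hx _ hc rfl
        · exact hy1 c hc' hc
        · exact hy3 x hx hc
      · refine (Finset.forall_mem_insert _ _ _).2 ⟨⟨Set.subset_union_right, hy4⟩, fun y' hy' =>
          ⟨(hB y' hy').1.trans Set.subset_union_left, (hB y' hy').2⟩⟩)
  obtain ⟨i, j, hij, hmem⟩ := h x y (⋃ n, (s n).1) fun i j hij =>
    Set.mem_iUnion.2 ⟨j, hup i j hij⟩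
  obtain ⟨k, hk⟩ := Set.mem_iUnion.1 hmem
  obtain ⟨A, B, -, -, hdisj, -, -⟩ := hI (max i k)
  exact Set.disjoint_left.1 hdisj ((hs (le_max_right i k)).1 hk)
    ((hs (le_max_left i k)).2 (hlo i j hij))

end HasNoSeparatedProducts

/-- By the dichotomy, the kernel of every functional on `ℓ₁(T, ω)` is, in both orders, a product of
functions of one variable, whatever the weight. -/
theorem HasNoSeparatedProducts.isArensRegular {T : Type*} [Semigroup T]
    (h : HasNoSeparatedProducts T) (ω : SemigroupWeight T) : IsArensRegular (WeightedL1 ω) := by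
  refine WeightedL1.isArensRegular_iff.2 fun f U V a b l l' ha hb hl hl' => ?_
  have hf : ∀ x y, f (WeightedL1.dirac ω x * WeightedL1.dirac ω y) =
      ((ω x : ℝ) : ℂ)⁻¹ * ((ω y : ℝ) : ℂ)⁻¹ * (ω (x * y) * f (WeightedL1.dirac ω (x * y))) :=
    fun x y => by
      rw [WeightedL1.dirac_mul_dirac, map_smul, smul_eq_mul]
      push_cast
      rw [div_eq_mul_inv, mul_inv]
      ring
  simp only [hf] at ha hb
  rcases h.dichotomy U V with hd | hd
  · obtain ⟨y₀, hy₀⟩ := hd.exists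
    refine eq_of_eventually_eq_mul
      (G := fun x => ((ω x : ℝ) : ℂ)⁻¹ * (ω (x * y₀) * f (WeightedL1.dirac ω (x * y₀))))
      (h := fun y => ((ω y : ℝ) : ℂ)⁻¹) ?_ ?_ ha hb hl hl'
    · refine hy₀.mono fun x hx => hx.mono fun y hy => ?_
      rw [hy]
      ring
    · refine hd.mono fun y hy => (hy.and hy₀).mono fun x hx => ?_
      obtain ⟨y', h1, h2⟩ := (hx.1.and hx.2).exists
      rw [← h1, h2]
      ring
  · obtain ⟨x₀, hx₀⟩ := hd.exists
    refine eq_of_eventually_eq_mul (G := fun x => ((ω x : ℝ) : ℂ)⁻¹)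
      (h := fun y => ((ω y : ℝ) : ℂ)⁻¹ * (ω (x₀ * y) * f (WeightedL1.dirac ω (x₀ * y))))
      ?_ ?_ ha hb hl hl'
    · refine hd.mono fun x hx => (hx.and hx₀).mono fun y hy => ?_
      obtain ⟨x', h1, h2⟩ := (hy.1.and hy.2).exists
      rw [← h1, h2]
      ring
    · refine hx₀.mono fun y hy => hy.mono fun x hx => ?_
      rw [hx]
      ring

theorem corollary2p3 {S : Type*} {T : Type*} [Semigroup S] [Semigroup T]
    (ψ : S →ₙ* T) (hψ : Function.Surjective ψ)
    (hS : IsArensRegular (WeightedL1 (trivialWeight S))) :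
    ∀ ω : SemigroupWeight T, IsArensRegular (WeightedL1 ω) :=
  ((hasNoSeparatedProducts_of_isArensRegular hS).of_surjective ψ hψ).isArensRegular
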